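/- **Theorem 2 (Karhunen–Loève expansion for Hilbertian flows/fields).** Let $\mathcal T$ be a compact subset of a Euclidean space $\mathbb R^d$ such that every nonempty relatively open subset of $\mathcal T$ has positive Lebesgue measure, let $\mathbb H$ be a separable real Hilbert space, and for $u,v\in\mathbb H$ let $u\otimes v$ be the operator $(u\otimes v)h=\langle u,h\rangle v$. Let $\{\chi(t):t\in\mathcal T\}$ be a (jointly measurable) $\mathbb H$-valued process on a probability space that is second-order, i.e. $\mathbb E[\chi(t)]$ and $K(s,t)=\mathbb E[\chi(s)\otimes\chi(t)]$ exist as Bochner integrals for all $s,t\in\mathcal T$, and mean-square continuous, i.e. $\mathbb E\|\chi(t_n)-\chi(t)\|_{\mathbb H}^2\to0$ whenever $t_n\to t$ in $\mathcal T$. Let $$(\mathcal A f)(t)=\int_{\mathcal T}K(u,t)f(u)\,du,\qquad f\in L^2(\mathcal T,\mathbb H),$$ so that $\mathcal A$ is the covariance operator $f\mapsto\mathbb E[\langle\chi,f\rangle_{L^2(\mathcal T,\mathbb H)}\,\chi]$. Let $\{\Phi_j\}_{j\ge1}$, a finite or infinite sequence, be the eigenfunctions of $\mathcal A$: an orthonormal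 system of eigenfunctions in $L^2(\mathcal T,\mathbb H)$ such that no nonzero eigenfunction belonging to a nonzero eigenvalue is orthogonal to all $\Phi_j$ (eigenfunctions for the eigenvalue $0$ may or may not be included). Each $\Phi_j$ belonging to a nonzero eigenvalue is taken to be its continuous representative; for the eigenvalue $0$ any representative may be used. Define $$\chi_n(t)=\sum_{j\le n}\langle\chi,\Phi_j\rangle_{L^2(\mathcal T,\mathbb H)}\,\Phi_j(t),\qquad t\in\mathcal T,$$ the sum being over all the eigenfunctions if there are fewer than $n$ of them. Then almost every path of $\chi$ lies in $L^2(\mathcal T,\mathbb H)$, $\mathbb E\|\chi_n(t)\|_{\mathbb H}^2<\infty$ for all $n$ and $t$, and $$\lim_{n\to\infty}\ \sup_{t\in\mathcal T}\ \mathbb E\big[\|\chi_n(t)-\chi(t)\|_{\mathbb H}^2\big]=0 .$$ -/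

import Mathlib

open MeasureTheory Filter Topology
open scoped ENNReal

noncomputable section

namespace HilbertianFlow

variable {H : Type*} [NormedAddCommGroup H] [InnerProductSpace ℝ H]

/-- The operator `u ⊗ v : H → H`, `(u ⊗ v) h = ⟨u, h⟩ v`. -/
def tensorOp (u v : H) : H →L[ℝ] H :=
  InnerProductSpace.rankOne ℝ v u

theorem tensorOp_apply (u v h : H) : tensorOp u v h = inner ℝ u h • v := by
  simp [tensorOp]

/-- Lebesgue measure on a subset `T` of a Euclidean space, as a measure on the type of points
of `T`. -/
def lebesgueOn {d : ℕ} (T : Set (EuclideanSpace ℝ (Fin d))) : Measure T :=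
  Measure.comap Subtype.val volume

variable {S Ω : Type*} [MeasurableSpace S] [MeasurableSpace Ω]

/-- `χ` is a second-order process under the probability `P`: the mean `E[χ(t)]` and the
(operator-valued) covariance kernel `E[χ(s) ⊗ χ(t)]` exist as Bochner integrals. -/
def IsSecondOrder (P : Measure Ω) (χ : S → Ω → H) : Prop :=
  (∀ t, Integrable (χ t) P) ∧
    ∀ s t, Integrable (fun ω => tensorOp (χ s ω) (χ t ω)) P

/-- `χ` is mean-square continuous: `E‖χ(tₙ) - χ(t)‖² → 0` whenever `tₙ → t`. -/
def IsMeanSquareContinuous [TopologicalSpace S] (P : Measure Ω) (χ : S → Ω → H) : Prop :=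
  ∀ (t : S) (τ : ℕ → S), Tendsto τ atTop (𝓝 t) →
    Tendsto (fun n => ∫⁻ ω, ‖χ (τ n) ω - χ t ω‖ₑ ^ 2 ∂P) atTop (𝓝 0)

/-- The covariance kernel `K(s,t) = E[χ(s) ⊗ χ(t)]`, a Bochner integral in the bounded
operators on `H`. -/
def covKernel (P : Measure Ω) (χ : S → Ω → H) (s t : S) : H →L[ℝ] H :=
  ∫ ω, tensorOp (χ s ω) (χ t ω) ∂P

/-- The integral operator of an operator-valued kernel, `(A f)(t) = ∫ K(u,t) f(u) du`.
As `(u ⊗ v) h = ⟨u, h⟩ v`, for `K(u,t) = E[χ(u) ⊗ χ(t)]` this is the covariance operator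
`f ↦ E[⟨χ, f⟩ χ]`; the integration is over the argument of the factor paired with `f`. -/
def integralOp (μ : Measure S) (K : S → S → H →L[ℝ] H) (f : S → H) (t : S) : H :=
  ∫ u, K u t (f u) ∂μ

/-- `⟨f, g⟩ = ∫ ⟨f(t), g(t)⟩ dt`, the inner product of `L²`. -/
def innerL2 (μ : Measure S) (f g : S → H) : ℝ :=
  ∫ t, inner ℝ (f t) (g t) ∂μ

/-- `f` is a square integrable function with `A f = l f` in `L²` (`f = 0` is not excluded). -/
def IsEigen (μ : Measure S) (K : S → S → H →L[ℝ] H) (l : ℝ) (f : S → H) : Prop :=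
  MemLp f 2 μ ∧ integralOp μ K f =ᵐ[μ] fun t => l • f t

/-- `(l j, Φ j)`, `j < N` with `N ≤ ∞`, are the eigenvalue and eigenfunction pairs of the
integral operator of `K`, listed in any order and with multiplicity: the `Φ j` are orthonormal
eigenfunctions, and there is no further nonzero eigenfunction orthogonal to all of them that
belongs to a nonzero eigenvalue. Eigenfunctions for the eigenvalue zero may be listed or not.
An eigenfunction for a nonzero eigenvalue is given by its continuous representative. -/
structure IsEigenSystem [TopologicalSpace S] (μ : Measure S) (K : S → S → H →L[ℝ] H)
    (N : ℕ∞) (l : ℕ → ℝ) (Φ : ℕ → S → H) : Prop where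
  eigen : ∀ j : ℕ, (j : ℕ∞) < N → IsEigen μ K (l j) (Φ j)
  norm_one : ∀ j : ℕ, (j : ℕ∞) < N → innerL2 μ (Φ j) (Φ j) = 1
  orthogonal : ∀ i j : ℕ, (i : ℕ∞) < N → (j : ℕ∞) < N → i ≠ j → innerL2 μ (Φ i) (Φ j) = 0
  exhaustive : ∀ (r : ℝ) (f : S → H), r ≠ 0 → IsEigen μ K r f →
    (∀ j : ℕ, (j : ℕ∞) < N → innerL2 μ f (Φ j) = 0) → f =ᵐ[μ] 0
  continuous : ∀ j : ℕ, (j : ℕ∞) < N → l j ≠ 0 → Continuous (Φ j)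

/-- The truncated expansion `χₙ(t) = ∑ ⟨χ, Φ j⟩ Φ j (t)`, the sum being over the first `n`
indices (over all of them if there are fewer than `n`). -/
def partialSum (μ : Measure S) (χ : S → Ω → H) (N : ℕ∞) (Φ : ℕ → S → H)
    (n : ℕ) (t : S) (ω : Ω) : H :=
  ∑ j ∈ Finset.range n with ((j : ℕ) : ℕ∞) < N, innerL2 μ (fun s => χ s ω) (Φ j) • Φ j t

end HilbertianFlow

end

/-! The path of `χ` is a random element `ζ` of `L²(T, H)`, and by Fubini its covariance operator is
`A` (`covOp_path`). `A` is compact and symmetric, so it vanishes on every `f` orthogonal to all `Φ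
j`; then `E⟨ζ, f⟩² = ⟨A f, f⟩ = 0`. Hence `ζ` lies almost surely in the closed span of the `Φ j`,
and its expansion converges in mean square (`tendsto_lintegral_partial_expansion`), that is, `∫
E‖χₙ(t) - χ(t)‖² dt → 0`.

Uniformity needs no Mercer theorem. The coefficients `ξ j = ⟨χ, Φ j⟩` are uncorrelated and `E[ξ j
χ(t)] = E[ξ j ²] Φ j (t)` at every `t`, so `χₙ(t)` is the orthogonal projection of `χ(t)` in `L²(P;
H)` on the `H`-valued span of the first coefficients. The residual is thus a contraction applied to
`χ(t)` (`eLpNorm_sum_smul_sub_le`), and all residuals share the modulus of continuity of `t ↦ χ(t)`.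
On a compact space with a measure charging open sets, this upgrades `L²` convergence to uniform
convergence (`tendsto_iSup_sq_of_tendsto_lintegral`). -/

namespace HilbertianFlow

/-! ### Expansion of a random element of a Hilbert space -/

section Hilbert

open scoped InnerProductSpace

variable {E : Type*} [NormedAddCommGroup E] [InnerProductSpace ℝ E]
variable {Ω : Type*} [MeasurableSpace Ω] {P : Measure Ω} {ζ : Ω → E}

/-- The covariance operator `f ↦ E[⟨ζ, f⟩ ζ]` of a random element `ζ` of a Hilbert space. -/
noncomputable def covOp (P : Measure Ω) (ζ : Ω → E) : E →L[ℝ] E :=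
  ∫ ω, InnerProductSpace.rankOne ℝ (ζ ω) (ζ ω) ∂P

theorem integrable_rankOne_self (hζ : MemLp ζ 2 P) :
    Integrable (fun ω => InnerProductSpace.rankOne ℝ (ζ ω) (ζ ω)) P := by
  refine (hζ.integrable_norm_pow (by norm_num)).mono' ?_ ?_
  · have hc : Continuous fun x : E => InnerProductSpace.rankOne ℝ x x :=
      (InnerProductSpace.rankOne ℝ).continuous.clm_apply continuous_id
    exact hc.comp_aestronglyMeasurable hζ.1
  · exact ae_of_all _ fun ω => by simp [sq]

theorem inner_covOp [CompleteSpace E] (hζ : MemLp ζ 2 P) (f g : E) :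
    ⟪covOp P ζ f, g⟫_ℝ = ∫ ω, ⟪ζ ω, f⟫_ℝ * ⟪ζ ω, g⟫_ℝ ∂P := by
  have hi := integrable_rankOne_self hζ
  rw [covOp, ContinuousLinearMap.integral_apply hi, real_inner_comm,
    ← integral_inner (hi.apply_continuousLinearMap f)]
  refine integral_congr_ae (ae_of_all _ fun ω => ?_)
  simp [real_inner_smul_right, real_inner_comm]

theorem covOp_isSymmetric [CompleteSpace E] (hζ : MemLp ζ 2 P) : (covOp P ζ).IsSymmetric := by
  intro f g
  change ⟪covOp P ζ f, g⟫_ℝ = ⟪f, covOp P ζ g⟫_ℝ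
  rw [real_inner_comm _ f, inner_covOp hζ, inner_covOp hζ]
  simp only [mul_comm]

theorem isCompactOperator_rankOne (x y : E) :
    IsCompactOperator (InnerProductSpace.rankOne ℝ x y) := by
  rw [InnerProductSpace.rankOne_def']
  have h : IsCompactOperator (innerSL ℝ y : E →L[ℝ] ℝ) :=
    ⟨Metric.closedBall 0 1, isCompact_closedBall _ _,
      (innerSL ℝ y).continuous.continuousAt (by
        simpa using Metric.closedBall_mem_nhds (0 : ℝ) one_pos)⟩
  exact h.clm_comp (.toSpanSingleton ℝ x)

/-- Compact operators form a closed convex set, which contains the mean of any integrable random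
element of it. -/
theorem isCompactOperator_covOp [CompleteSpace E] [IsProbabilityMeasure P] (hζ : MemLp ζ 2 P) :
    IsCompactOperator (covOp P ζ) := by
  have h : covOp P ζ ∈ {f : E →L[ℝ] E | IsCompactOperator f} :=
    ((compactOperator (RingHom.id ℝ) E E).restrictScalars ℝ).convex.integral_mem
      isClosed_setOfPred_isCompactOperator
      (ae_of_all _ fun ω => isCompactOperator_rankOne (ζ ω) (ζ ω)) (integrable_rankOne_self hζ)
  exact h

/-- A compact symmetric operator vanishes on the orthogonal complement of any family of
eigenvectors that is orthogonal to no further eigenvector of a nonzero eigenvalue. -/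
theorem apply_eq_zero_of_forall_inner_eq_zero [CompleteSpace E] {A : E →L[ℝ] E}
    (hc : IsCompactOperator A) (hs : A.IsSymmetric) {ι : Type*} {φ : ι → E} {l : ι → ℝ}
    (heig : ∀ i, A (φ i) = l i • φ i)
    (hex : ∀ (r : ℝ) (f : E), r ≠ 0 → A f = r • f → (∀ i, ⟪f, φ i⟫_ℝ = 0) → f = 0)
    {f : E} (hf : ∀ i, ⟪f, φ i⟫_ℝ = 0) : A f = 0 := by
  set U : Submodule ℝ E := (Submodule.span ℝ (Set.range φ))ᗮ
  have hU : ∀ g, g ∈ U ↔ ∀ i, ⟪g, φ i⟫_ℝ = 0 := fun g => by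
    rw [Submodule.mem_orthogonal']
    refine ⟨fun h i => h _ (Submodule.subset_span ⟨i, rfl⟩), fun h u hu => ?_⟩
    induction hu using Submodule.span_induction with
    | mem x hx => obtain ⟨i, rfl⟩ := hx; exact h i
    | zero => simp
    | add x y _ _ hx hy => simp [inner_add_right, hx, hy]
    | smul a x _ hx => simp [real_inner_smul_right, hx]
  have hinv : ∀ g ∈ U, A g ∈ U := fun g hg => by
    rw [hU] at hg ⊢
    intro i
    have h := hs g (φ i)
    change ⟪A g, φ i⟫_ℝ = ⟪g, A (φ i)⟫_ℝ at h
    rw [h, heig, real_inner_smul_right, hg, mul_zero]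
  -- `A` restricted to the invariant subspace `U` is compact and symmetric without nonzero
  -- eigenvalues, hence zero.
  have hS := (ContinuousLinearMap.eq_zero_of_forall_hasEigenvalue_eq_zero
    (T := A.restrict hinv) (hc.restrict' hinv) (hs.restrict_invariant hinv)).1 fun r hr => by
      obtain ⟨v, hv, hv0⟩ := hr.exists_hasEigenvector
      by_contra hr0
      rw [Module.End.mem_eigenspace_iff] at hv
      exact hv0 (Subtype.ext (hex r v hr0 (congrArg Subtype.val hv) ((hU v).1 v.2)))
  exact congrArg Subtype.val (DFunLike.congr_fun hS (⟨f, (hU f).2 hf⟩ : U))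

/-- **Pettis' theorem** in a separable Hilbert space. -/
theorem aestronglyMeasurable_of_forall_inner [CompleteSpace E] [SecondCountableTopology E]
    (h : ∀ f : E, AEStronglyMeasurable (fun ω => ⟪f, ζ ω⟫_ℝ) P) :
    AEStronglyMeasurable ζ P := by
  set U : ℕ → Submodule ℝ E := fun n =>
    Submodule.span ℝ (TopologicalSpace.denseSeq E '' (Finset.range n : Set ℕ))
  have hfin : ∀ n, FiniteDimensional ℝ (U n) := fun n =>
    FiniteDimensional.span_of_finite ℝ ((Finset.finite_toSet _).image _)
  have hmono : Monotone U := fun m n hmn =>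
    Submodule.span_mono (Set.image_mono (by simpa using hmn))
  have htop : ⊤ ≤ (⨆ n, U n).topologicalClosure := by
    intro x _
    refine closure_mono ?_ (TopologicalSpace.denseRange_denseSeq E x)
    rintro _ ⟨k, rfl⟩
    exact Submodule.mem_iSup_of_mem (k + 1) (Submodule.subset_span ⟨k, by simp, rfl⟩)
  -- `ζ` is the pointwise limit of its projections on finite-dimensional spaces, whose coordinates
  -- are measurable by `h`.
  refine aestronglyMeasurable_of_tendsto_ae atTop
    (f := fun n ω => (U n).starProjection (ζ ω)) (fun n => ?_)
    (ae_of_all _ fun ω => Submodule.starProjection_tendsto_self U hmono (ζ ω) htop)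
  have hsum : (fun ω => (U n).starProjection (ζ ω)) = fun ω =>
      ∑ i, ⟪(stdOrthonormalBasis ℝ (U n) i : E), ζ ω⟫_ℝ • (stdOrthonormalBasis ℝ (U n) i : E) := by
    funext ω
    rw [(stdOrthonormalBasis ℝ (U n)).starProjection_eq_sum_rankOne]
    simp
  rw [hsum]
  exact Finset.aestronglyMeasurable_fun_sum _ fun i _ => (h _).smul_const _

/-- The projection of `ζ` on the complement of `s` is tested against one vector at a time;
separability merges the null sets into one. -/
theorem ae_mem_closure_span [CompleteSpace E] [SecondCountableTopology E] {s : Set E}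
    (h : ∀ f : E, (∀ g ∈ s, ⟪f, g⟫_ℝ = 0) → ∀ᵐ ω ∂P, ⟪ζ ω, f⟫_ℝ = 0) :
    ∀ᵐ ω ∂P, ζ ω ∈ (Submodule.span ℝ s).topologicalClosure := by
  set U : Submodule ℝ E := (Submodule.span ℝ s)ᗮ
  have h0 : (fun ω => U.starProjection (ζ ω)) =ᵐ[P] 0 := by
    refine ae_eq_zero_of_forall_inner (𝕜 := ℝ) fun c => ?_
    filter_upwards [h (U.starProjection c) fun g hg =>
      (Submodule.mem_orthogonal' _ _).1 (Submodule.starProjection_apply_mem U c) g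
        (Submodule.subset_span hg)] with ω hω
    rw [← Submodule.inner_starProjection_left_eq_right, real_inner_comm, hω, Pi.zero_apply]
  filter_upwards [h0] with ω hω
  rw [← Submodule.orthogonal_orthogonal_eq_closure]
  exact (Submodule.starProjection_apply_eq_zero_iff U).1 hω

variable {p : ℕ → Prop} [DecidablePred p] {φ : ℕ → E}

theorem sum_inner_smul_eq_starProjection
    (h1 : ∀ j, p j → ⟪φ j, φ j⟫_ℝ = 1) (h0 : ∀ i j, p i → p j → i ≠ j → ⟪φ i, φ j⟫_ℝ = 0)
    (n : ℕ) (x : E)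
    [(Submodule.span ℝ (φ '' {j | j < n ∧ p j})).HasOrthogonalProjection] :
    ∑ j ∈ Finset.range n with p j, ⟪x, φ j⟫_ℝ • φ j =
      (Submodule.span ℝ (φ '' {j | j < n ∧ p j})).starProjection x := by
  refine (Submodule.eq_starProjection_of_mem_of_inner_eq_zero ?_ fun w hw => ?_).symm
  · refine Submodule.sum_mem _ fun j hj =>
      Submodule.smul_mem _ _ (Submodule.subset_span ⟨j, ?_, rfl⟩)
    simpa using hj
  · induction hw using Submodule.span_induction with
    | mem y hy =>
      obtain ⟨k, ⟨hk, hpk⟩, rfl⟩ := hy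
      rw [inner_sub_left, sum_inner, Finset.sum_eq_single_of_mem k (by simp [hk, hpk])]
      · rw [real_inner_smul_left, h1 k hpk, mul_one, sub_self]
      · intro j hj hjk
        rw [real_inner_smul_left, h0 j k (by simp_all) hpk hjk, mul_zero]
    | zero => simp
    | add y z _ _ hy hz => simp [inner_add_right, hy, hz]
    | smul a y _ hy => simp [real_inner_smul_right, hy]

/-- The expansion of a random element of a Hilbert space along the eigenvectors of its covariance
operator converges in mean square. -/
theorem tendsto_lintegral_partial_expansion [CompleteSpace E] [SecondCountableTopology E]
    [IsProbabilityMeasure P] (hζ : MemLp ζ 2 P)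
    (h1 : ∀ j, p j → ⟪φ j, φ j⟫_ℝ = 1) (h0 : ∀ i j, p i → p j → i ≠ j → ⟪φ i, φ j⟫_ℝ = 0)
    {l : ℕ → ℝ} (heig : ∀ j, p j → covOp P ζ (φ j) = l j • φ j)
    (hex : ∀ (r : ℝ) (f : E), r ≠ 0 → covOp P ζ f = r • f → (∀ j, p j → ⟪f, φ j⟫_ℝ = 0) → f = 0) :
    Tendsto (fun n => ∫⁻ ω, ‖∑ j ∈ Finset.range n with p j, ⟪ζ ω, φ j⟫_ℝ • φ j - ζ ω‖ₑ ^ 2 ∂P)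
      atTop (𝓝 0) := by
  set U : ℕ → Submodule ℝ E := fun n => Submodule.span ℝ (φ '' {j | j < n ∧ p j})
  have hfin : ∀ n, FiniteDimensional ℝ (U n) := fun n =>
    FiniteDimensional.span_of_finite ℝ (((Set.finite_lt_nat n).subset fun j hj => hj.1).image _)
  have hmono : Monotone U := fun m n hmn =>
    Submodule.span_mono (Set.image_mono fun j hj => ⟨hj.1.trans_le hmn, hj.2⟩)
  have hspan : Submodule.span ℝ (φ '' {j | p j}) ≤ ⨆ n, U n := by
    rw [Submodule.span_le]
    rintro _ ⟨j, hj, rfl⟩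
    exact Submodule.mem_iSup_of_mem (j + 1)
      (Submodule.subset_span ⟨j, ⟨Nat.lt_succ_self j, hj⟩, rfl⟩)
  have hmem : ∀ᵐ ω ∂P, ζ ω ∈ (⨆ n, U n).topologicalClosure := by
    have := ae_mem_closure_span (P := P) (ζ := ζ) (s := φ '' {j | p j}) fun f hf => by
      have hA : covOp P ζ f = 0 := apply_eq_zero_of_forall_inner_eq_zero
        (isCompactOperator_covOp hζ) (covOp_isSymmetric hζ) (φ := fun i : {j // p j} => φ i)
        (l := fun i => l i) (fun i => heig i i.2)
        (fun r g hr hg hgi => hex r g hr hg fun j hj => hgi ⟨j, hj⟩)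
        (fun i => hf _ ⟨i, i.2, rfl⟩)
      have hint := inner_covOp hζ f f
      rw [hA, inner_zero_left, eq_comm, integral_eq_zero_iff_of_nonneg
        (fun ω => mul_self_nonneg _)] at hint
      · exact hint.mono fun ω hω => mul_self_eq_zero.1 hω
      · exact (hζ.inner_const f).integrable_mul (hζ.inner_const f)
    exact this.mono fun ω hω => Submodule.topologicalClosure_mono hspan hω
  simp_rw [sum_inner_smul_eq_starProjection h1 h0]
  have hmeas : ∀ n, AEMeasurable (fun ω => ‖(U n).starProjection (ζ ω) - ζ ω‖ₑ ^ 2) P := fun n =>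
    (((U n).starProjection.continuous.comp_aestronglyMeasurable hζ.1).sub hζ.1).enorm.pow_const 2
  -- The residual is the complementary projection of `ζ`, so `‖ζ‖²` dominates.
  have := tendsto_lintegral_of_dominated_convergence' (μ := P) (f := fun _ => 0)
    (fun ω => ‖ζ ω‖ₑ ^ 2) hmeas (fun n => ae_of_all _ fun ω => ?_) ?_ ?_
  · simpa using this
  · have hle : ‖(U n).starProjection (ζ ω) - ζ ω‖ ≤ ‖ζ ω‖ := by
      rw [norm_sub_rev, ← Submodule.starProjection_orthogonal_val]
      exact Submodule.norm_starProjection_apply_le _ _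
    simpa using pow_le_pow_left' (enorm_le_iff_norm_le.2 hle) 2
  · have := (hζ.integrable_norm_pow (by norm_num)).2
    simpa [HasFiniteIntegral] using this.ne
  · filter_upwards [hmem] with ω hω
    have ht := Submodule.starProjection_tendsto_closure_iSup U hmono (ζ ω)
    rw [Submodule.starProjection_eq_self_iff.2 hω] at ht
    have := (ENNReal.continuous_pow 2).tendsto _ |>.comp (ht.sub_const (ζ ω)).enorm
    simpa [Function.comp_def] using this

end Hilbert

/-! ### Square integrable functions and projection on orthogonal random variables -/

section SquareIntegrable

open scoped InnerProductSpace

variable {α : Type*} [MeasurableSpace α] {ν : Measure α}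

theorem eLpNorm_two_sq {H : Type*} [NormedAddCommGroup H] (f : α → H) :
    eLpNorm f 2 ν ^ 2 = ∫⁻ x, ‖f x‖ₑ ^ 2 ∂ν := by
  have := eLpNorm_nnreal_pow_eq_lintegral (μ := ν) (f := f) (p := 2) (by norm_num)
  simpa using this

theorem memLp_two_iff_lintegral {H : Type*} [NormedAddCommGroup H] {f : α → H} :
    MemLp f 2 ν ↔ AEStronglyMeasurable f ν ∧ ∫⁻ x, ‖f x‖ₑ ^ 2 ∂ν < ∞ := by
  rw [MemLp, ← eLpNorm_two_sq, ENNReal.pow_lt_top_iff]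
  simp

variable {H : Type*} [NormedAddCommGroup H] [InnerProductSpace ℝ H]

theorem integrable_smul_of_memLp_two {ξ : α → ℝ} {Y : α → H} (hξ : MemLp ξ 2 ν)
    (hY : MemLp Y 2 ν) : Integrable (fun x => ξ x • Y x) ν :=
  memLp_one_iff_integrable.1 (hY.smul hξ)

theorem integrable_inner_of_memLp_two {X Y : α → H} (hX : MemLp X 2 ν)
    (hY : MemLp Y 2 ν) : Integrable (fun x => ⟪X x, Y x⟫_ℝ) ν :=
  (hX.norm.integrable_mul hY.norm).mono' (hX.1.inner hY.1)
    (ae_of_all _ fun x => norm_inner_le_norm (X x) (Y x))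

theorem memLp_two_smul_prod {β : Type*} [MeasurableSpace β] {ρ : Measure β} [SFinite ν] [SFinite ρ]
    {f : α → H} {ξ : β → ℝ} (hf : MemLp f 2 ν) (hξ : MemLp ξ 2 ρ) :
    MemLp (fun z : α × β => ξ z.2 • f z.1) 2 (ν.prod ρ) := by
  refine (memLp_two_iff_integrable_sq_norm (hξ.1.comp_snd.smul hf.1.comp_fst)).2 ?_
  refine ((hf.integrable_norm_pow (by norm_num)).mul_prod
    (hξ.integrable_norm_pow (by norm_num))).congr (ae_of_all _ fun z => ?_)
  simp [norm_smul, mul_pow, mul_comm]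

theorem inner_toLp {X Y : α → H} (hX : MemLp X 2 ν) (hY : MemLp Y 2 ν) :
    ⟪hX.toLp X, hY.toLp Y⟫_ℝ = ∫ x, ⟪X x, Y x⟫_ℝ ∂ν := by
  rw [L2.inner_def]
  refine integral_congr_ae ?_
  filter_upwards [hX.coeFn_toLp, hY.coeFn_toLp] with x h1 h2
  rw [h1, h2]

variable {ι : Type*} {F : Finset ι} {ξ : ι → α → ℝ} {a : ι → H} {Y : α → H}

theorem memLp_sum_smul_const (hξ : ∀ i ∈ F, MemLp (ξ i) 2 ν) :
    MemLp (fun x => ∑ i ∈ F, ξ i x • a i) 2 ν :=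
  memLp_finsetSum F fun i hi => 
    (ContinuousLinearMap.toSpanSingleton ℝ (a i)).comp_memLp' (hξ i hi)

/-- The right side involves `Y` only through the moments in `hc`, so `Y` and its projection can be
compared through it. -/
theorem integral_inner_sum_smul [CompleteSpace H] (hξ : ∀ i ∈ F, MemLp (ξ i) 2 ν) (hY : MemLp Y 2 ν)
    (hc : ∀ i ∈ F, ∫ x, ξ i x • Y x ∂ν = (∫ x, ξ i x * ξ i x ∂ν) • a i) :
    ∫ x, ⟪∑ i ∈ F, ξ i x • a i, Y x⟫_ℝ ∂ν = ∑ i ∈ F, (∫ x, ξ i x * ξ i x ∂ν) * ⟪a i, a i⟫_ℝ := by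
  simp_rw [sum_inner, real_inner_smul_left]
  have h : ∀ i ∈ F, Integrable (fun x => ξ i x • Y x) ν := fun i hi =>
    integrable_smul_of_memLp_two (hξ i hi) hY
  simp_rw [← real_inner_smul_right]
  rw [integral_finsetSum _ fun i hi => (h i hi).const_inner (a i)]
  refine Finset.sum_congr rfl fun i hi => ?_
  rw [integral_inner (h i hi), hc i hi, real_inner_smul_right]

/-- Subtracting from a square integrable `Y` its projection `∑ ξ i • a i` on the `H`-valued span of
orthogonal random variables does not increase the norm. -/
theorem eLpNorm_sum_smul_sub_le [CompleteSpace H] (hξ : ∀ i ∈ F, MemLp (ξ i) 2 ν) (hY : MemLp Y 2 ν)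
    (h0 : ∀ i ∈ F, ∀ j ∈ F, i ≠ j → ∫ x, ξ i x * ξ j x ∂ν = 0)
    (hc : ∀ i ∈ F, ∫ x, ξ i x • Y x ∂ν = (∫ x, ξ i x * ξ i x ∂ν) • a i) :
    eLpNorm (fun x => ∑ i ∈ F, ξ i x • a i - Y x) 2 ν ≤ eLpNorm Y 2 ν := by
  have hW : MemLp (fun x => ∑ i ∈ F, ξ i x • a i) 2 ν := memLp_sum_smul_const hξ
  have hcW : ∀ i ∈ F, ∫ x, ξ i x • ∑ j ∈ F, ξ j x • a j ∂ν = (∫ x, ξ i x * ξ i x ∂ν) • a i := by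
    intro i hi
    simp_rw [Finset.smul_sum, smul_smul]
    have hint : ∀ j ∈ F, Integrable (fun x => (ξ i x * ξ j x) • a j) ν := fun j hj =>
      ((hξ i hi).integrable_mul (hξ j hj)).smul_const (a j)
    rw [integral_finsetSum _ hint,
      Finset.sum_eq_single_of_mem i hi fun j hj hji => ?_]
    · exact integral_smul_const _ _
    · rw [integral_smul_const, h0 i hi j hj hji.symm, zero_smul]
  -- `Y` and `W` have the same moments against each `ξ i`, whence `Y - W` is orthogonal to `W`.
  have hin : ⟪hW.toLp _, hY.toLp _⟫_ℝ = ⟪hW.toLp _, hW.toLp _⟫_ℝ := by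
    rw [inner_toLp, inner_toLp, integral_inner_sum_smul hξ hY hc, integral_inner_sum_smul hξ hW hcW]
  have hle : ‖hW.toLp _ - hY.toLp _‖ ≤ ‖hY.toLp _‖ := by
    refine le_of_sq_le_sq ?_ (norm_nonneg _)
    rw [norm_sub_sq_real, hin, real_inner_self_eq_norm_sq]
    nlinarith [sq_nonneg ‖hW.toLp _‖]
  rw [← MemLp.toLp_sub, ← enorm_le_iff_norm_le, Lp.enorm_toLp, Lp.enorm_toLp] at hle
  exact hle

end SquareIntegrable

/-- Functions on a compact space with a common modulus of continuity converge to zero uniformly if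
they do so in `L²` of a measure that is positive on nonempty open sets. -/
theorem tendsto_iSup_sq_of_tendsto_lintegral {S M : Type*} [TopologicalSpace S] [CompactSpace S]
    [MeasurableSpace S] [OpensMeasurableSpace S] {μ : Measure S} [μ.IsOpenPosMeasure]
    [PseudoEMetricSpace M] {X : S → M} (hX : Continuous X) {e : ℕ → S → ℝ≥0∞}
    (he : ∀ n s t, e n s ≤ e n t + edist (X s) (X t))
    (hlim : Tendsto (fun n => ∫⁻ t, e n t ^ 2 ∂μ) atTop (𝓝 0)) :
    Tendsto (fun n => ⨆ t, e n t ^ 2) atTop (𝓝 0) := by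
  have key : ∀ ε : ℝ≥0∞, 0 < ε → ε ≠ ∞ → ∀ᶠ n in atTop, ∀ t, e n t ≤ ε + ε := by
    intro ε hε hεt
    have hopen : ∀ t, IsOpen (X ⁻¹' Metric.eball (X t) (ε / 2)) := fun t =>
      Metric.isOpen_eball.preimage hX
    have hε2 : 0 < ε / 2 := ENNReal.half_pos hε.ne'
    have hself : ∀ t, t ∈ X ⁻¹' Metric.eball (X t) (ε / 2) := fun t =>
      Metric.mem_eball_self hε2
    obtain ⟨F, hF⟩ := isCompact_univ.elim_finite_subcover _ hopen
      fun t _ => Set.mem_iUnion.2 ⟨t, hself t⟩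
    have hpos : ∀ t, 0 < ε ^ 2 * μ (X ⁻¹' Metric.eball (X t) (ε / 2)) := fun t =>
      ENNReal.mul_pos (pow_ne_zero 2 hε.ne') ((hopen t).measure_pos μ ⟨t, hself t⟩).ne'
    -- Two points of one patch are at distance at most `ε` under `X`, so `e n t > 2ε` forces `e n ≥
    -- ε` on a whole patch around `t`; its share of the integral is then too large.
    have hev : ∀ᶠ n in atTop, ∀ i ∈ F,
        ∫⁻ t, e n t ^ 2 ∂μ < ε ^ 2 * μ (X ⁻¹' Metric.eball (X i) (ε / 2)) :=
      (Filter.eventually_all_finset F).2 fun i _ => hlim.eventually_lt_const (hpos i)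
    filter_upwards [hev] with n hn t
    obtain ⟨i, hi, hti⟩ := Set.mem_iUnion₂.1 (hF (Set.mem_univ t))
    by_contra! hlt
    refine (hn i hi).not_ge ?_
    rw [← setLIntegral_const]
    refine (setLIntegral_mono' (hopen i).measurableSet fun s hs => ?_).trans
      (setLIntegral_le_lintegral _ _)
    refine pow_le_pow_left' ?_ 2
    have hd : edist (X t) (X s) ≤ ε :=
      (edist_triangle_right _ _ (X i)).trans
        ((add_le_add (le_of_lt hti) (le_of_lt hs)).trans (ENNReal.add_halves ε).le)
    by_contra! hs'
    exact (hlt.trans_le (he n t s)).not_ge (add_le_add hs'.le hd)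
  rw [ENNReal.tendsto_atTop_zero]
  intro ε hε
  obtain ⟨δ, hδ, hδε⟩ : ∃ δ : ℝ≥0∞, 0 < δ ∧ δ ≠ ∞ ∧ (δ + δ) ^ 2 < ε := by
    have hc : Continuous fun δ : ℝ≥0∞ => (δ + δ) ^ 2 := by fun_prop
    have h := (hc.tendsto 0).eventually_lt_const (show ((0 : ℝ≥0∞) + 0) ^ 2 < ε by simpa using hε)
    obtain ⟨b, hb, hb'⟩ := (ENNReal.nhds_zero_basis.eventually_iff).1 h
    obtain ⟨δ, h1, h2⟩ := exists_between hb
    exact ⟨δ, h1, h2.ne_top, hb' h2⟩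
  obtain ⟨n₀, hn₀⟩ := eventually_atTop.1 (key δ hδ hδε.1)
  exact ⟨n₀, fun n hn => iSup_le fun t => (pow_le_pow_left' (hn₀ n hn t) 2).trans hδε.2.le⟩

/-! ### The process as a continuous curve in `L²(P; H)` -/

section MeanSquare

variable {S Ω H : Type*} [MeasurableSpace Ω] {P : Measure Ω} [NormedAddCommGroup H]
  [InnerProductSpace ℝ H] {χ : S → Ω → H}

/-- On the diagonal, `‖u ⊗ u‖ = ‖u‖²`. -/
theorem IsSecondOrder.memLp (h : IsSecondOrder P χ) (t : S) : MemLp (χ t) 2 P := by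
  rw [memLp_two_iff_integrable_sq_norm (h.1 t).1]
  simpa [tensorOp, sq] using (h.2 t t).norm

omit [InnerProductSpace ℝ H] in
theorem IsMeanSquareContinuous.continuous_toLp [TopologicalSpace S] [SequentialSpace S]
    (hc : IsMeanSquareContinuous P χ) (hX : ∀ t, MemLp (χ t) 2 P) :
    Continuous fun t => (hX t).toLp (χ t) := by
  refine SeqContinuous.continuous fun τ t hτ => ?_
  rw [tendsto_iff_edist_tendsto_0]
  have h := (hc t τ hτ)
  simp_rw [← eLpNorm_two_sq] at h
  have h2 := h.ennrpow_const (1 / 2 : ℝ)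
  simp_rw [← ENNReal.rpow_natCast, ← ENNReal.rpow_mul] at h2
  simp only [Function.comp_def, Lp.edist_toLp_toLp]
  simpa [Pi.sub_def] using h2

end MeanSquare

/-! ### The random path and its covariance operator -/

section RandomField

open scoped InnerProductSpace

variable {S Ω H : Type*} [MeasurableSpace S] {μ : Measure S} [NormedAddCommGroup H]
  {χ : S → Ω → H}

open Classical in
/-- The path `t ↦ χ t ω` as an element of `L²`, zero if it is not square integrable. -/
noncomputable def path (μ : Measure S) (χ : S → Ω → H) (ω : Ω) : Lp H 2 μ :=
  if h : MemLp (fun t => χ t ω) 2 μ then h.toLp _ else 0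

theorem path_eq_toLp {ω : Ω} (h : MemLp (fun t => χ t ω) 2 μ) : path μ χ ω = h.toLp _ :=
  dif_pos h

variable [MeasurableSpace Ω] {P : Measure Ω}

theorem ae_memLp_path [SFinite μ] [SFinite P] (hχ : MemLp (Function.uncurry χ) 2 (μ.prod P)) :
    ∀ᵐ ω ∂P, MemLp (fun t => χ t ω) 2 μ := by
  filter_upwards [hχ.1.prodMk_right, (hχ.integrable_norm_pow (by norm_num)).prod_left_ae]
    with ω h1 h2
  exact (memLp_two_iff_integrable_sq_norm h1).2 h2

/-- A continuous curve on a compact space is bounded, so `E‖χ(t)‖²` is bounded in `t`. -/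
theorem memLp_uncurry [TopologicalSpace S] [CompactSpace S] [IsFiniteMeasure μ] [SFinite P]
    (hm : AEStronglyMeasurable (Function.uncurry χ) (μ.prod P)) {hX : ∀ t, MemLp (χ t) 2 P}
    (hc : Continuous fun t => (hX t).toLp (χ t)) :
    MemLp (Function.uncurry χ) 2 (μ.prod P) := by
  refine memLp_two_iff_lintegral.2 ⟨hm, ?_⟩
  obtain ⟨C, hC⟩ := isCompact_univ.exists_bound_of_continuousOn hc.continuousOn
  rw [lintegral_prod _ (hm.enorm.pow_const 2)]
  calc ∫⁻ t, ∫⁻ ω, ‖Function.uncurry χ (t, ω)‖ₑ ^ 2 ∂P ∂μ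
      ≤ ∫⁻ _, ENNReal.ofReal C ^ 2 ∂μ := by
        refine lintegral_mono fun t => ?_
        change ∫⁻ ω, ‖χ t ω‖ₑ ^ 2 ∂P ≤ _
        rw [← eLpNorm_two_sq, ← Lp.enorm_toLp (hX t), ← ofReal_norm]
        exact pow_le_pow_left' (ENNReal.ofReal_le_ofReal (hC t (Set.mem_univ t))) 2
    _ < ∞ := by
        rw [lintegral_const]
        exact ENNReal.mul_lt_top (by simp) (measure_lt_top μ _)

variable [InnerProductSpace ℝ H] {f : S → H}

theorem ae_innerL2_eq_inner_path [SFinite μ] [SFinite P]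
    (hχ : MemLp (Function.uncurry χ) 2 (μ.prod P)) (hf : MemLp f 2 μ) :
    ∀ᵐ ω ∂P, innerL2 μ (fun t => χ t ω) f = ⟪path μ χ ω, hf.toLp f⟫_ℝ := by
  filter_upwards [ae_memLp_path hχ] with ω hω
  rw [path_eq_toLp hω, inner_toLp, innerL2]

theorem aestronglyMeasurable_innerL2 [SFinite μ] [SFinite P]
    (hχ : MemLp (Function.uncurry χ) 2 (μ.prod P)) (hf : MemLp f 2 μ) :
    AEStronglyMeasurable (fun ω => innerL2 μ (fun t => χ t ω) f) P :=
  by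
  have h : AEStronglyMeasurable (fun z : S × Ω => ⟪χ z.1 z.2, f z.1⟫_ℝ) (μ.prod P) :=
    hχ.1.inner hf.1.comp_fst
  exact h.prod_swap.integral_prod_right'

/-- Fubini gives measurability of the scalar coefficients of the path, and Pettis' theorem that of
the path itself. -/
theorem memLp_path [CompleteSpace H] [SecondCountableTopology (Lp H 2 μ)] [SFinite μ] [SFinite P]
    (hχ : MemLp (Function.uncurry χ) 2 (μ.prod P)) : MemLp (path μ χ) 2 P := by
  refine memLp_two_iff_lintegral.2 ⟨aestronglyMeasurable_of_forall_inner fun f => ?_, ?_⟩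
  · refine (aestronglyMeasurable_innerL2 hχ (Lp.memLp f)).congr ?_
    filter_upwards [ae_innerL2_eq_inner_path hχ (Lp.memLp f)] with ω hω
    rw [hω, Lp.toLp_coeFn, real_inner_comm]
  · have h := (memLp_two_iff_lintegral.1 hχ).2
    rw [lintegral_prod_symm _ (hχ.1.enorm.pow_const 2)] at h
    refine lt_of_eq_of_lt (lintegral_congr_ae ?_) h
    filter_upwards [ae_memLp_path hχ] with ω hω
    rw [path_eq_toLp hω, Lp.enorm_toLp, eLpNorm_two_sq]
    rfl

theorem memLp_innerL2 [CompleteSpace H] [SecondCountableTopology (Lp H 2 μ)] [SFinite μ]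
    [SFinite P] (hχ : MemLp (Function.uncurry χ) 2 (μ.prod P)) (hf : MemLp f 2 μ) :
    MemLp (fun ω => innerL2 μ (fun t => χ t ω) f) 2 P :=
  ((memLp_path hχ).inner_const (hf.toLp f)).ae_eq
    ((ae_innerL2_eq_inner_path hχ hf).mono fun _ h => h.symm)

/-- `A f (t) = E[⟨χ, f⟩ χ(t)]` at every point `t`. -/
theorem integralOp_covKernel [CompleteSpace H] [SFinite μ] [SFinite P]
    (h2 : ∀ s t, Integrable (fun ω => tensorOp (χ s ω) (χ t ω)) P)
    (hχ : MemLp (Function.uncurry χ) 2 (μ.prod P)) (hf : MemLp f 2 μ) {t : S}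
    (ht : MemLp (χ t) 2 P) :
    integralOp μ (covKernel P χ) f t = ∫ ω, innerL2 μ (fun s => χ s ω) f • χ t ω ∂P := by
  -- The bound `‖χ(u)‖ · (‖f(u)‖ ‖χ(t)‖)` is a product of two square integrable functions of `(u,
  -- ω)`.
  have hint : Integrable (Function.uncurry fun u ω => ⟪χ u ω, f u⟫_ℝ • χ t ω) (μ.prod P) := by
    refine (hχ.norm.integrable_mul (memLp_two_smul_prod hf ht.norm).norm).mono'
      ((hχ.1.inner hf.1.comp_fst).smul ht.1.comp_snd) (ae_of_all _ fun z => ?_)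
    simp only [Function.uncurry, norm_smul, Pi.mul_apply, norm_norm]
    rw [mul_comm ‖χ t z.2‖, ← mul_assoc]
    gcongr
    exact norm_inner_le_norm _ _
  calc integralOp μ (covKernel P χ) f t = ∫ u, ∫ ω, ⟪χ u ω, f u⟫_ℝ • χ t ω ∂P ∂μ := by
        refine integral_congr_ae (ae_of_all _ fun u => ?_)
        simp only [covKernel, ContinuousLinearMap.integral_apply (h2 u t), tensorOp_apply]
    _ = ∫ ω, ∫ u, ⟪χ u ω, f u⟫_ℝ • χ t ω ∂μ ∂P := integral_integral_swap hint
    _ = _ := by simp only [integral_smul_const, innerL2]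

-- By Cauchy–Schwarz. This makes `A f` continuous, so that eigenfunction identities hold at every
-- point and not just almost everywhere.
omit [MeasurableSpace S] in
theorem continuous_integral_smul [TopologicalSpace S] {hX : ∀ t, MemLp (χ t) 2 P}
    (hc : Continuous fun t => (hX t).toLp (χ t)) {ξ : Ω → ℝ} (hξ : MemLp ξ 2 P) :
    Continuous fun t => ∫ ω, ξ ω • χ t ω ∂P := by
  refine continuous_iff_continuousAt.2 fun t => ?_
  refine tendsto_integral_of_L1' _ (integrable_smul_of_memLp_two hξ (hX t)).1
    (Eventually.of_forall fun s => integrable_smul_of_memLp_two hξ (hX s)) ?_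
  have h := tendsto_iff_edist_tendsto_0.1 (hc.tendsto t)
  simp_rw [Lp.edist_toLp_toLp] at h
  have h' := ENNReal.Tendsto.const_mul (a := eLpNorm ξ 2 P) h (Or.inr hξ.2.ne)
  rw [mul_zero] at h'
  refine tendsto_of_tendsto_of_tendsto_of_le_of_le tendsto_const_nhds h' (fun _ => zero_le)
    fun s => ?_
  have hs : ((fun ω => ξ ω • χ s ω) - fun ω => ξ ω • χ t ω) = ξ • (χ s - χ t) := by
    funext ω
    simp [smul_sub]
  rw [hs]
  exact eLpNorm_smul_le_mul_eLpNorm ((hX s).1.sub (hX t).1) hξ.1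

/-- The covariance operator of the random path is the integral operator of the covariance
kernel. -/
theorem covOp_path [CompleteSpace H] [SecondCountableTopology (Lp H 2 μ)] [SFinite μ] [SFinite P]
    (h2 : ∀ s t, Integrable (fun ω => tensorOp (χ s ω) (χ t ω)) P)
    (hX : ∀ t, MemLp (χ t) 2 P)
    (hχ : MemLp (Function.uncurry χ) 2 (μ.prod P)) (hf : MemLp f 2 μ)
    (hA : MemLp (integralOp μ (covKernel P χ) f) 2 μ) :
    covOp P (path μ χ) (hf.toLp f) = hA.toLp _ := by
  refine ext_inner_right ℝ fun g => ?_
  have hξ := memLp_innerL2 hχ hf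
  have hg := Lp.memLp g
  have hint : Integrable (Function.uncurry fun t ω =>
      ⟪innerL2 μ (fun s => χ s ω) f • χ t ω, g t⟫_ℝ) (μ.prod P) := by
    refine (integrable_inner_of_memLp_two hχ (memLp_two_smul_prod hg hξ)).congr
      (ae_of_all _ fun z => ?_)
    simp only [Function.uncurry, real_inner_smul_left, real_inner_smul_right]
  calc ⟪covOp P (path μ χ) (hf.toLp f), g⟫_ℝ
      = ∫ ω, innerL2 μ (fun s => χ s ω) f * innerL2 μ (fun s => χ s ω) g ∂P := by
        rw [inner_covOp (memLp_path hχ)]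
        refine integral_congr_ae ?_
        filter_upwards [ae_innerL2_eq_inner_path hχ hf, ae_innerL2_eq_inner_path hχ hg]
          with ω h1 h3
        rw [h1, h3, Lp.toLp_coeFn]
    _ = ∫ ω, ∫ t, ⟪innerL2 μ (fun s => χ s ω) f • χ t ω, g t⟫_ℝ ∂μ ∂P := by
        simp only [real_inner_smul_left, integral_const_mul, innerL2]
    _ = ∫ t, ∫ ω, ⟪innerL2 μ (fun s => χ s ω) f • χ t ω, g t⟫_ℝ ∂P ∂μ :=
        (integral_integral_swap hint).symm
    _ = ∫ t, ⟪integralOp μ (covKernel P χ) f t, g t⟫_ℝ ∂μ := by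
        refine integral_congr_ae (ae_of_all _ fun t => ?_)
        simp only [integralOp_covKernel h2 hχ hf (hX t)]
        rw [real_inner_comm,
          ← integral_inner (integrable_smul_of_memLp_two hξ (hX t))]
        simp only [real_inner_comm]
    _ = ⟪hA.toLp _, g⟫_ℝ := by
        rw [← inner_toLp hA hg, Lp.toLp_coeFn]

end RandomField

/-! ### The uniform expansion on a compact parameter space -/

section Expansion

open scoped InnerProductSpace

variable {H : Type*} [NormedAddCommGroup H] [InnerProductSpace ℝ H] [CompleteSpace H]
  [SecondCountableTopology H]
variable {S Ω : Type*} [TopologicalSpace S] [CompactSpace S] [SequentialSpace S]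
  [MeasurableSpace S] [BorelSpace S] [MeasurableSpace.CountablyGenerated S] [MeasurableSpace Ω]
  {μ : Measure S} [IsFiniteMeasure μ] [μ.IsOpenPosMeasure] {P : Measure Ω} [IsProbabilityMeasure P]
  {χ : S → Ω → H}

omit [InnerProductSpace ℝ H] [CompleteSpace H] [SequentialSpace S]
  [MeasurableSpace.CountablyGenerated S] [μ.IsOpenPosMeasure] in
theorem memLp_of_continuous {f : S → H} (hf : Continuous f) : MemLp f 2 μ := by
  obtain ⟨C, hC⟩ := isCompact_univ.exists_bound_of_continuousOn hf.continuousOn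
  exact MemLp.of_bound hf.aestronglyMeasurable C (ae_of_all _ fun t => hC t (Set.mem_univ t))

/-- The **Karhunen–Loève expansion** of a mean-square continuous Hilbert-space valued process on a
compact space converges in mean square, uniformly in the parameter. -/
theorem karhunenLoeve
    (hmeas : AEStronglyMeasurable (Function.uncurry χ) (μ.prod P))
    (hsecond : IsSecondOrder P χ) (hcont : IsMeanSquareContinuous P χ)
    {N : ℕ∞} {l : ℕ → ℝ} {Φ : ℕ → S → H} (hΦ : IsEigenSystem μ (covKernel P χ) N l Φ) :
    (∀ᵐ ω ∂P, MemLp (fun t => χ t ω) 2 μ) ∧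
    (∀ n t, MemLp (partialSum μ χ N Φ n t) 2 P) ∧
    Tendsto (fun n => ⨆ t, ∫⁻ ω, ‖partialSum μ χ N Φ n t ω - χ t ω‖ₑ ^ 2 ∂P) atTop (𝓝 0) := by
  -- Needed by the instance of second countability of `Lp H 2 μ`.
  have : Fact ((2 : ℝ≥0∞) ≠ ∞) := ⟨ENNReal.ofNat_ne_top⟩
  have hX := hsecond.memLp
  have hc := hcont.continuous_toLp hX
  have hχ := memLp_uncurry hmeas hc
  have hpath := memLp_path hχ
  have hop : ∀ f, MemLp f 2 μ → ∀ t, integralOp μ (covKernel P χ) f t =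
      ∫ ω, innerL2 μ (fun s => χ s ω) f • χ t ω ∂P := fun f hf t =>
    integralOp_covKernel hsecond.2 hχ hf (hX t)
  have hcop : ∀ f, MemLp f 2 μ → Continuous (integralOp μ (covKernel P χ) f) := fun f hf => by
    rw [funext (hop f hf)]
    exact continuous_integral_smul hc (memLp_innerL2 hχ hf)
  have hcov : ∀ f (hf : MemLp f 2 μ), covOp P (path μ χ) (hf.toLp f) =
      (memLp_of_continuous (hcop f hf)).toLp _ := fun f hf =>
    covOp_path hsecond.2 hX hχ hf _
  set p : ℕ → Prop := fun j => (j : ℕ∞) < N with hp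
  have hm : ∀ j, p j → MemLp (Φ j) 2 μ := fun j hj => (hΦ.eigen j hj).1
  obtain ⟨φ, hφ⟩ : ∃ φ : ℕ → Lp H 2 μ, ∀ j (hj : p j), φ j = (hm j hj).toLp (Φ j) := by
    classical
    exact ⟨fun j => if hj : p j then (hm j hj).toLp (Φ j) else 0, fun j hj => dif_pos hj⟩
  have hφφ : ∀ i j, p i → p j → ⟪φ i, φ j⟫_ℝ = innerL2 μ (Φ i) (Φ j) := fun i j hi hj => by
    rw [hφ i hi, hφ j hj, inner_toLp, innerL2]
  have h1 : ∀ j, p j → ⟪φ j, φ j⟫_ℝ = 1 := fun j hj => by rw [hφφ j j hj hj, hΦ.norm_one j hj]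
  have h0 : ∀ i j, p i → p j → i ≠ j → ⟪φ i, φ j⟫_ℝ = 0 := fun i j hi hj hij => by
    rw [hφφ i j hi hj, hΦ.orthogonal i j hi hj hij]
  have heig : ∀ j, p j → covOp P (path μ χ) (φ j) = l j • φ j := fun j hj => by
    rw [hφ j hj, hcov, ← MemLp.toLp_const_smul]
    exact MemLp.toLp_congr _ _ (hΦ.eigen j hj).2
  have hex : ∀ (r : ℝ) (f : Lp H 2 μ), r ≠ 0 → covOp P (path μ χ) f = r • f →
      (∀ j, p j → ⟪f, φ j⟫_ℝ = 0) → f = 0 := fun r f hr hf hfj => by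
    have hf2 := Lp.memLp f
    have hfc := hcov f hf2
    rw [Lp.toLp_coeFn, hf] at hfc
    refine (Lp.eq_zero_iff_ae_eq_zero).2 (hΦ.exhaustive r f hr ⟨hf2, ?_⟩ fun j hj => ?_)
    · filter_upwards [(memLp_of_continuous (hcop f hf2)).coeFn_toLp, Lp.coeFn_smul r f] with t a b
      rw [← a, ← hfc, b, Pi.smul_apply]
    · rw [← hfj j hj, hφ j hj, innerL2, ← inner_toLp hf2, Lp.toLp_coeFn]
  set ξ : ℕ → Ω → ℝ := fun j ω => innerL2 μ (fun s => χ s ω) (Φ j) with hξdef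
  have hξ : ∀ j, p j → MemLp (ξ j) 2 P := fun j hj => memLp_innerL2 hχ (hm j hj)
  have hξφ : ∀ᵐ ω ∂P, ∀ j, p j → ξ j ω = ⟪path μ χ ω, φ j⟫_ℝ := by
    rw [ae_all_iff]
    intro j
    by_cases hj : p j
    · filter_upwards [ae_innerL2_eq_inner_path hχ (hm j hj)] with ω hω _
      rw [hφ j hj, ← hω]
    · exact ae_of_all _ fun ω h => absurd h hj
  have hξξ : ∀ i j, p i → p j → ∫ ω, ξ i ω * ξ j ω ∂P = l i * ⟪φ i, φ j⟫_ℝ := fun i j hi hj => by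
    rw [← real_inner_smul_left, ← heig i hi, inner_covOp hpath]
    refine integral_congr_ae (hξφ.mono fun ω hω => ?_)
    simp only [hω i hi, hω j hj]
  have hξχ : ∀ j, p j → ∀ t, ∫ ω, ξ j ω • χ t ω ∂P = (∫ ω, ξ j ω * ξ j ω ∂P) • Φ j t := by
    intro j hj t
    rw [hξξ j j hj hj, h1 j hj, mul_one]
    -- For eigenvalue zero, `ξ j` vanishes almost surely and the representative of `Φ j` does not
    -- matter. Otherwise both sides are continuous in `t` and agree almost everywhere, hence
    -- everywhere, as `μ` charges open sets.
    by_cases hl : l j = 0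
    · have h := hξξ j j hj hj
      rw [hl, zero_mul, integral_eq_zero_iff_of_nonneg (fun ω => mul_self_nonneg _)
        ((hξ j hj).integrable_mul (hξ j hj))] at h
      rw [hl, zero_smul]
      refine integral_eq_zero_of_ae (h.mono fun ω hω => ?_)
      simp [mul_self_eq_zero.1 hω]
    · rw [← hop _ (hm j hj)]
      exact congrFun (((hcop _ (hm j hj)).ae_eq_iff_eq μ
        ((hΦ.continuous j hj hl).const_smul (l j))).1 (hΦ.eigen j hj).2) t
  have hpF : ∀ n, ∀ j ∈ (Finset.range n).filter p, p j := fun n j hj => (Finset.mem_filter.1 hj).2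
  have hps : ∀ n t, MemLp (partialSum μ χ N Φ n t) 2 P := fun n t =>
    memLp_sum_smul_const fun j hj => hξ j (hpF n j hj)
  refine ⟨ae_memLp_path hχ, hps, ?_⟩
  simp_rw [← eLpNorm_two_sq]
  refine tendsto_iSup_sq_of_tendsto_lintegral (μ := μ) hc (fun n s t => ?_) ?_
  · rw [Lp.edist_toLp_toLp]
    have hsub := (hX s).sub (hX t)
    -- The residual of the increment `χ s - χ t`, with the increments of the `Φ j` as projection
    -- coefficients.
    have hle : eLpNorm (fun ω => ∑ j ∈ Finset.range n with p j, ξ j ω • (Φ j s - Φ j t) -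
        (χ s - χ t) ω) 2 P ≤ eLpNorm (χ s - χ t) 2 P := by
      refine eLpNorm_sum_smul_sub_le (fun j hj => hξ j (hpF n j hj)) hsub
        (fun i hi j hj hij => ?_) fun j hj => ?_
      · rw [hξξ i j (hpF n i hi) (hpF n j hj), h0 i j (hpF n i hi) (hpF n j hj) hij, mul_zero]
      · have hj := hpF n j hj
        simp_rw [Pi.sub_apply, smul_sub]
        rw [integral_sub (integrable_smul_of_memLp_two (hξ j hj) (hX s))
          (integrable_smul_of_memLp_two (hξ j hj) (hX t)), hξχ j hj, hξχ j hj]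
    have hsplit : (fun ω => partialSum μ χ N Φ n s ω - χ s ω) =
        (fun ω => partialSum μ χ N Φ n t ω - χ t ω) + fun ω =>
          ∑ j ∈ Finset.range n with p j, ξ j ω • (Φ j s - Φ j t) - (χ s - χ t) ω := by
      funext ω
      simp only [partialSum, Pi.add_apply, Pi.sub_apply, smul_sub, Finset.sum_sub_distrib, hξdef,
        hp]
      abel
    rw [hsplit]
    refine (eLpNorm_add_le ((hps n t).1.sub (hX t).1) ?_ one_le_two).trans (add_le_add le_rfl hle)
    exact (memLp_sum_smul_const fun j hj => hξ j (hpF n j hj)).1.sub hsub.1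
  · refine (tendsto_lintegral_partial_expansion hpath h1 h0 heig hex).congr fun n => ?_
    simp_rw [eLpNorm_two_sq]
    have hjoint : AEStronglyMeasurable
        (Function.uncurry fun t ω => partialSum μ χ N Φ n t ω - χ t ω) (μ.prod P) := by
      refine AEStronglyMeasurable.sub ?_ hmeas
      exact Finset.aestronglyMeasurable_fun_sum _ fun j hj =>
        (hξ j (hpF n j hj)).1.comp_snd.smul (hm j (hpF n j hj)).1.comp_fst
    -- Tonelli identifies the integrated pointwise error with the mean square error of the path in
    -- `L²`.
    rw [lintegral_lintegral_swap (hjoint.enorm.pow_const 2)]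
    refine lintegral_congr_ae ?_
    filter_upwards [hξφ, ae_memLp_path hχ] with ω hω hω2
    rw [← eLpNorm_two_sq, Lp.enorm_def]
    congr 1
    refine eLpNorm_congr_ae ?_
    have hsum : ∀ j ∈ (Finset.range n).filter p,
        ⇑(⟪path μ χ ω, φ j⟫_ℝ • φ j) =ᵐ[μ] fun t => ξ j ω • Φ j t := fun j hj => by
      have hj := hpF n j hj
      filter_upwards [Lp.coeFn_smul (⟪path μ χ ω, φ j⟫_ℝ) (φ j), (hm j hj).coeFn_toLp] with t a b
      rw [a, Pi.smul_apply, hω j hj, hφ j hj, b]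
    have hpe := hω2.coeFn_toLp
    rw [← path_eq_toLp hω2] at hpe
    filter_upwards [Lp.coeFn_sub (∑ j ∈ Finset.range n with p j, ⟪path μ χ ω, φ j⟫_ℝ • φ j)
      (path μ χ ω), Lp.coeFn_fun_finsetSum ((Finset.range n).filter p)
        (fun j => ⟪path μ χ ω, φ j⟫_ℝ • φ j), hpe,
      (Filter.eventually_all_finset _).2 hsum] with t a b c d
    rw [a, Pi.sub_apply, b, c, partialSum]
    exact congrArg (· - χ t ω) (Finset.sum_congr rfl d)

end Expansion

/-! ### Lebesgue measure on the compact set -/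

section Lebesgue

variable {d : ℕ} {T : Set (EuclideanSpace ℝ (Fin d))}

/-- `Measure.comap` takes the default value zero unless images of measurable sets are null
measurable, which `hT` ensures. -/
theorem lebesgueOn_apply_preimage (hT : MeasurableSet T) (U : Set (EuclideanSpace ℝ (Fin d))) :
    lebesgueOn T (Subtype.val ⁻¹' U) = volume (T ∩ U) := by
  rw [lebesgueOn, (MeasurableEmbedding.subtype_coe hT).comap_apply, Subtype.image_preimage_coe]

theorem isFiniteMeasure_lebesgueOn (hT : IsCompact T) : IsFiniteMeasure (lebesgueOn T) := by
  refine ⟨?_⟩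
  rw [← Set.preimage_univ (f := Subtype.val), lebesgueOn_apply_preimage hT.measurableSet,
    Set.inter_univ]
  exact hT.measure_lt_top

theorem isOpenPosMeasure_lebesgueOn (hT : MeasurableSet T)
    (hTpos : ∀ U : Set (EuclideanSpace ℝ (Fin d)), IsOpen U → (T ∩ U).Nonempty →
      0 < volume (T ∩ U)) : (lebesgueOn T).IsOpenPosMeasure := by
  refine ⟨?_⟩
  rintro _ ⟨U, hU, rfl⟩ ⟨x, hx⟩
  rw [lebesgueOn_apply_preimage hT]
  exact (hTpos U hU ⟨x, x.2, hx⟩).ne'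

end Lebesgue

end HilbertianFlow

theorem theorem2 {d : ℕ} (T : Set (EuclideanSpace ℝ (Fin d))) (hT : IsCompact T)
    -- every nonempty relatively open subset of `T` has positive Lebesgue measure
    (hTpos : ∀ U : Set (EuclideanSpace ℝ (Fin d)), IsOpen U → (T ∩ U).Nonempty →
      0 < volume (T ∩ U))
    {H : Type*} [NormedAddCommGroup H] [InnerProductSpace ℝ H] [CompleteSpace H]
    [TopologicalSpace.SeparableSpace H]
    {Ω : Type*} [MeasurableSpace Ω] (P : Measure Ω) [IsProbabilityMeasure P]
    (χ : T → Ω → H)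
    (hmeas : AEStronglyMeasurable (Function.uncurry χ) ((HilbertianFlow.lebesgueOn T).prod P))
    (hsecond : HilbertianFlow.IsSecondOrder P χ)
    (hcont : HilbertianFlow.IsMeanSquareContinuous P χ)
    (N : ℕ∞) (l : ℕ → ℝ) (Φ : ℕ → T → H)
    (hΦ : HilbertianFlow.IsEigenSystem (HilbertianFlow.lebesgueOn T)
      (HilbertianFlow.covKernel P χ) N l Φ) :
    -- almost every path lies in `L²(T, H)`, so that its coefficients are defined
    (∀ᵐ ω ∂P, MemLp (fun t => χ t ω) 2 (HilbertianFlow.lebesgueOn T)) ∧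
    -- the truncated expansion is a random element of `H` with finite second moment
    (∀ n t, MemLp (HilbertianFlow.partialSum (HilbertianFlow.lebesgueOn T) χ N Φ n t) 2 P) ∧
    Tendsto
      (fun n => ⨆ t : T,
        ∫⁻ ω, ‖HilbertianFlow.partialSum (HilbertianFlow.lebesgueOn T) χ N Φ n t ω - χ t ω‖ₑ ^ 2 ∂P)
      atTop (𝓝 0) := by
  have : CompactSpace T := isCompact_iff_compactSpace.1 hT
  have := HilbertianFlow.isFiniteMeasure_lebesgueOn hT
  have := HilbertianFlow.isOpenPosMeasure_lebesgueOn hT.measurableSet hTpos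
  have : SecondCountableTopology H := UniformSpace.secondCountable_of_separable H
  exact HilbertianFlow.karhunenLoeve hmeas hsecond hcont hΦ
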